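/- Theorem 5.1. Let $B\subset\mathbb{R}^N$ be an arbitrary (nonempty) polytope, i.e. the convex hull of a nonempty finite set, and let $C=\{(y,\phi)\mid y\in\phi B,\ \phi\ge 0\}$ be its induced cone. Let $\tilde W$ be a positive diagonal $N\times N$ matrix, $a\in\mathbb{R}^N$ and $\delta>0$. Put $\langle x,y\rangle_{\tilde W}=\sum_i\tilde W_{ii}x_iy_i$, $\|x\|_{\tilde W}=\sqrt{\langle x,x\rangle_{\tilde W}}$, $Q=\max_{q\in B}\|q\|_{\tilde W}$, $h(y,\phi)=\|y-a\|_{\tilde W}^2+\phi^2$ and $h^*=\min_{(y,\phi)\in C}h(y,\phi)$. The conic min-norm-point method is the following algorithm. It keeps a finite active set $S^{(k)}\subset B$, coefficients $\lambda^{(k)}$ on it (a point that joins the set has coefficient $0$), the point $y^{(k)}$ and $\phi^{(k)}=\sum_{q\in S^{(k)}}\lambda^{(k)}_q$. It starts with $k=0$, an arbitrary $q_1\in B$, $S^{(0)}=\{q_1\}$, $\lambda^{(0)}_{q_1}=\max\{0,\ \langle a,q_1\rangle_{\tilde W}/(1+\|q_1\|_{\tilde W}^2)\}$ and $y^{(0)}=\lambda^{(0)}_{q_1}q_1$,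 and repeats the following MAJOR loop. 1. Take any $q^{(k)}\in\arg\min_{q\in B}\langle 2(y^{(k)}-a),q\rangle_{\tilde W}$. If $\langle y^{(k)}-a,q^{(k)}\rangle_{\tilde W}+\phi^{(k)}\ge-\delta$, stop. Otherwise replace $S^{(k)}$ by $S^{(k)}\cup\{q^{(k)}\}$. 2. (MINOR loop) Take any real coefficients $\alpha$ on $S^{(k)}$ that minimize $\|\sum_{q\in S^{(k)}}\alpha_q q-a\|_{\tilde W}^2+(\sum_{q\in S^{(k)}}\alpha_q)^2$, and put $z^{(k)}=\sum_{q\in S^{(k)}}\alpha_q q$. If some $\alpha_q<0$, put $\theta=\min_{q:\alpha_q<0}\lambda^{(k)}_q/(\lambda^{(k)}_q-\alpha_q)$, $\lambda^{(k+1)}=\theta\alpha+(1-\theta)\lambda^{(k)}$, $y^{(k+1)}=\theta z^{(k)}+(1-\theta)y^{(k)}$, $S^{(k+1)}=\{q\in S^{(k)}:\lambda^{(k+1)}_q>0\}$, increase $k$ by one and repeat step 2. If all $\alpha_q\ge 0$, put $\lambda^{(k+1)}=\alpha$, $y^{(k+1)}=z^{(k)}$, $S^{(k+1)}=\{q\in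 S^{(k)}:\alpha_q>0\}$, increase $k$ by one and go back to step 1. There is an absolute constant $M>0$ such that, for all $N,\tilde W,a,B,\delta$, every starting point $q_1\in B$ and all choices of the minimizers in steps 1 and 2, the following holds. All iterates satisfy $(y^{(k)},\phi^{(k)})\in C$. The values $h(y^{(k)},\phi^{(k)})$ decrease monotonically, that is $h(y^{(k+1)},\phi^{(k+1)})\le h(y^{(k)},\phi^{(k)})$, with strict inequality if the iterate $k$ starts a MAJOR loop (without stopping) and either $k\ge 1$ or $\langle a,q_1\rangle_{\tilde W}>0$. The algorithm never gets stuck, and it stops at some $$k\ \le\ M\cdot\frac{N\,\|a\|_{\tilde W}\,\max\{Q^2,1\}}{\delta},$$ and at that $k$ one has $h(y^{(k)},\phi^{(k)})\le h^*+\delta\|a\|_{\tilde W}$. -/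

import Mathlib

open scoped Pointwise

namespace ConicMNP

noncomputable section

/-- The inner product `⟨x, y⟩_W = ∑ i, W_ii x_i y_i`. A diagonal matrix `W` is given by the
vector `w` of its diagonal entries. -/
def wInner {N : ℕ} (w x y : Fin N → ℝ) : ℝ := ∑ i, w i * x i * y i

/-- The norm `‖x‖_W = √(∑ i, W_ii x_i ^ 2)`. -/
def wNorm {N : ℕ} (w x : Fin N → ℝ) : ℝ := √(∑ i, w i * x i ^ 2)

/-- The objective `h(y, φ) = ‖y - a‖_W ^ 2 + φ ^ 2`. -/
def obj {N : ℕ} (w a y : Fin N → ℝ) (φ : ℝ) : ℝ := wNorm w (y - a) ^ 2 + φ ^ 2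

/-- A (nonempty) polytope: the convex hull of a nonempty finite set of points. -/
def IsPolytope {N : ℕ} (B : Set (Fin N → ℝ)) : Prop :=
  ∃ V : Finset (Fin N → ℝ), V.Nonempty ∧ B = convexHull ℝ (V : Set (Fin N → ℝ))

/-- The cone `C = {(y, φ) | y ∈ φ B, φ ≥ 0}` induced by `B`. -/
def inducedCone {N : ℕ} (B : Set (Fin N → ℝ)) : Set ((Fin N → ℝ) × ℝ) :=
  {p | p.1 ∈ p.2 • B ∧ 0 ≤ p.2}

/-- The optimal value `h*` of the objective on the induced cone. -/
def optVal {N : ℕ} (w a : Fin N → ℝ) (B : Set (Fin N → ℝ)) : ℝ :=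
  sInf ((fun p : (Fin N → ℝ) × ℝ => obj w a p.1 p.2) '' inducedCone B)

/-- `Q = max_{q ∈ B} ‖q‖_W`. -/
def maxNorm {N : ℕ} (w : Fin N → ℝ) (B : Set (Fin N → ℝ)) : ℝ :=
  sSup (wNorm w '' B)

/-- The gradient of `y ↦ h(y, φ)` with respect to the inner product `⟨·, ·⟩_W`. -/
def gradY {N : ℕ} (a y : Fin N → ℝ) : Fin N → ℝ := (2 : ℝ) • (y - a)

/-- `gradY` represents the directional derivatives of the objective through `⟨·, ·⟩_W`. -/
theorem hasDerivAt_obj {N : ℕ} (w a y v : Fin N → ℝ) (φ : ℝ) (hw : ∀ i, 0 < w i) :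
    HasDerivAt (fun t : ℝ => obj w a (y + t • v) φ) (wInner w (gradY a y) v) 0 := by
  have h1 : (fun t : ℝ => obj w a (y + t • v) φ) =
      fun t : ℝ => (∑ i, w i * (y i + t * v i - a i) ^ 2) + φ ^ 2 := by
    funext t
    unfold obj wNorm
    rw [Real.sq_sqrt (Finset.sum_nonneg fun i _ => mul_nonneg (hw i).le (sq_nonneg _))]
    simp
  rw [h1]
  have h2 : wInner w (gradY a y) v =
      ∑ i, w i * (2 * (y i + 0 * v i - a i) * v i) := by
    unfold wInner gradY
    refine Finset.sum_congr rfl fun i _ => ?_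
    simp
    ring
  rw [h2]
  refine HasDerivAt.add_const _ (HasDerivAt.fun_sum fun i _ => ?_)
  refine HasDerivAt.const_mul _ ?_
  have h3 : HasDerivAt (fun t : ℝ => y i + t * v i - a i) (v i) 0 := by
    simpa using (((hasDerivAt_id (0 : ℝ)).mul_const (v i)).const_add (y i)).sub_const (a i)
  simpa using h3.fun_pow 2

/-- `∑_{q ∈ S} α_q q`. -/
def comb {N : ℕ} (S : Finset (Fin N → ℝ)) (α : (Fin N → ℝ) → ℝ) : Fin N → ℝ :=
  ∑ q ∈ S, α q • q

/-- `∑_{q ∈ S} α_q`. -/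
def total {N : ℕ} (S : Finset (Fin N → ℝ)) (α : (Fin N → ℝ) → ℝ) : ℝ :=
  ∑ q ∈ S, α q

/-- The data `(S^(k), λ^(k), y^(k))` held by the algorithm when its counter is `k`, and the place
in the program: `inMinor = false` says that the iterate `k` starts a MAJOR loop (Step 2 is next),
`inMinor = true` that it starts a further pass of the MINOR loop (Step 5 is next).
Coefficients are indexed by the points of the active set and are `0` elsewhere. -/
structure Config (N : ℕ) where
  active : Finset (Fin N → ℝ)
  coeff : (Fin N → ℝ) → ℝ
  point : Fin N → ℝ
  inMinor : Bool

/-- `φ^(k) = ∑_{q ∈ S^(k)} λ_q^(k)`. -/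
def Config.phi {N : ℕ} (c : Config N) : ℝ := total c.active c.coeff

/-- `h(y^(k), φ^(k))`. -/
def Config.value {N : ℕ} (w a : Fin N → ℝ) (c : Config N) : ℝ := obj w a c.point c.phi

/-- The first coefficient: the minimizer over `λ ≥ 0` of `h(λ q₁, λ)`, that is
`(⟨a, q₁⟩_W / (1 + ‖q₁‖_W ^ 2))_+`. -/
def initCoeff {N : ℕ} (w a q₁ : Fin N → ℝ) : ℝ :=
  max (wInner w a q₁ / (1 + wNorm w q₁ ^ 2)) 0

/-- Initialization: `S^(0) = {q₁}`, `y^(0) = λ₁ q₁`. -/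
def initConfig {N : ℕ} (w a q₁ : Fin N → ℝ) : Config N where
  active := {q₁}
  coeff := fun q => if q = q₁ then initCoeff w a q₁ else 0
  point := initCoeff w a q₁ • q₁
  inMinor := false

/-- Step 2: `q ∈ argmin_{q ∈ B} ⟨∇_y h(y, φ), q⟩_W`. -/
def IsOracle {N : ℕ} (w a : Fin N → ℝ) (B : Set (Fin N → ℝ)) (y q : Fin N → ℝ) : Prop :=
  q ∈ B ∧ ∀ p ∈ B, wInner w (gradY a y) q ≤ wInner w (gradY a y) p

/-- The algorithm stops (Steps 2 and 3): the iterate starts a MAJOR loop, and the point `q` of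
the oracle passes the test `⟨y - a, q⟩_W + φ ≥ -δ`. -/
def Stops {N : ℕ} (w a : Fin N → ℝ) (B : Set (Fin N → ℝ)) (δ : ℝ) (c : Config N) : Prop :=
  c.inMinor = false ∧
    ∃ q, IsOracle w a B c.point q ∧ -δ ≤ wInner w (c.point - a) q + c.phi

/-- The active set with which Step 5 is entered: at the start of a MAJOR loop it is enlarged by
the point `q` of the oracle, if this fails the stopping test (Steps 2 and 3); in the course of a
MINOR loop it is the current one. -/
def Enters {N : ℕ} (w a : Fin N → ℝ) (B : Set (Fin N → ℝ)) (δ : ℝ) (c : Config N)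
    (S : Finset (Fin N → ℝ)) : Prop :=
  (c.inMinor = false ∧
    ∃ q, IsOracle w a B c.point q ∧ wInner w (c.point - a) q + c.phi < -δ ∧
      S = insert q c.active) ∨
  (c.inMinor = true ∧ S = c.active)

/-- Step 5: `α` minimizes `‖∑_{q ∈ S} α_q q - a‖_W ^ 2 + (∑_{q ∈ S} α_q) ^ 2` over all real
coefficients on `S`. -/
def IsArgmin {N : ℕ} (w a : Fin N → ℝ) (S : Finset (Fin N → ℝ)) (α : (Fin N → ℝ) → ℝ) : Prop :=
  (∀ q, q ∉ S → α q = 0) ∧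
    ∀ β : (Fin N → ℝ) → ℝ, obj w a (comb S α) (total S α) ≤ obj w a (comb S β) (total S β)

/-- Step 7: `θ = min_{q ∈ S, α_q < 0} λ_q / (λ_q - α_q)`. -/
def IsRatio {N : ℕ} (S : Finset (Fin N → ℝ)) (lam α : (Fin N → ℝ) → ℝ) (θ : ℝ) : Prop :=
  IsLeast {t : ℝ | ∃ q ∈ S, α q < 0 ∧ t = lam q / (lam q - α q)} θ

/-- Steps 6 and 9: the configuration at the end of a MAJOR loop. -/
def closeMajor {N : ℕ} (S : Finset (Fin N → ℝ)) (α : (Fin N → ℝ) → ℝ) : Config N where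
  active := S.filter fun q => 0 < α q
  coeff := α
  point := comb S α
  inMinor := false

/-- Steps 7 and 8: the configuration after one pass of the MINOR loop. -/
def closeMinor {N : ℕ} (c : Config N) (S : Finset (Fin N → ℝ)) (α : (Fin N → ℝ) → ℝ) (θ : ℝ) :
    Config N where
  active := S.filter fun q => 0 < θ * α q + (1 - θ) * c.coeff q
  coeff := fun q => θ * α q + (1 - θ) * c.coeff q
  point := θ • comb S α + (1 - θ) • c.point
  inMinor := true

/-- `c'` may follow `c` when the counter moves from `k` to `k + 1`: no choice of the minimizers
in Steps 2 and 5 is excluded. -/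
def Step {N : ℕ} (w a : Fin N → ℝ) (B : Set (Fin N → ℝ)) (δ : ℝ) (c c' : Config N) : Prop :=
  ∃ S α, Enters w a B δ c S ∧ IsArgmin w a S α ∧
    (((∀ q ∈ S, 0 ≤ α q) ∧ c' = closeMajor S α) ∨
      ((∃ q ∈ S, α q < 0) ∧ ∃ θ, IsRatio S c.coeff α θ ∧ c' = closeMinor c S α θ))

/-- `c 0, …, c K` are the configurations of a run from the starting point `q₁` whose counter has
reached `K`. -/
def IsRun {N : ℕ} (w a : Fin N → ℝ) (B : Set (Fin N → ℝ)) (δ : ℝ) (q₁ : Fin N → ℝ)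
    (K : ℕ) (c : ℕ → Config N) : Prop :=
  c 0 = initConfig w a q₁ ∧ ∀ k < K, Step w a B δ (c k) (c (k + 1))

end

end ConicMNP

namespace ConicMNP

open scoped RealInnerProductSpace

/-! ### Least squares in an inner product space -/

section LeastSquares

variable {E : Type*} [NormedAddCommGroup E] [InnerProductSpace ℝ E]

/-! In ℝ^N × ℝ with the weighted inner product put x = (y, φ) and b = (a, 0). Then h = ‖x - b‖², the
cone is spanned by the generators (q, 1), and the method is an active-set method for nonnegative
least squares: ⟨y - a, q⟩ + φ is the inner product of the residual x - b with (q, 1). When a MAJOR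
loop starts, the residual is orthogonal to x. If its products with all generators are at least -g,
weak duality gives h - h* ≤ g ‖a‖ (`obj_sub_optVal_le`); g = δ is the guarantee at the stop.

If the test fails with g > δ, a line search along the new generator already lowers h by g² / ‖(q,
1)‖² ≥ g² / (1 + Q²), hence so does the minimization over the span. A single shortened step does not
spoil this gain (`Config.argmin_closeMinor_le`). Since the gap ε is at most g ‖a‖, 1/ε grows
steadily while ε ≥ δ ‖a‖, and below that ε falls by a fixed amount each time. The concave function
`saturate` merges the two phases into a potential that falls by 1 (`potential_add_one_le`).

A loop with two or more shortened steps may gain little, but it adds one active point and loses one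
per shortened step, so the active set shrinks. `WithinBudget` charges the counter to the potential
and the size of the active set together. -/

theorem norm_sq_add_smul (v p : E) (t : ℝ) :
    ‖v + t • p‖ ^ 2 = ‖v‖ ^ 2 + 2 * t * ⟪v, p⟫ + t ^ 2 * ‖p‖ ^ 2 := by
  rw [norm_add_sq_real, inner_smul_right, norm_smul, mul_pow, Real.norm_eq_abs, sq_abs]
  ring

theorem norm_sq_add_smul_optimal (v : E) {p : E} (hp : p ≠ 0) :
    ‖v + (-(⟪v, p⟫ / ‖p‖ ^ 2)) • p‖ ^ 2 = ‖v‖ ^ 2 - ⟪v, p⟫ ^ 2 / ‖p‖ ^ 2 := by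
  have : ‖p‖ ≠ 0 := norm_ne_zero_iff.2 hp
  rw [norm_sq_add_smul]
  field_simp
  ring

theorem inner_eq_zero_of_forall_norm_sq_le {v p : E}
    (h : ∀ t : ℝ, ‖v‖ ^ 2 ≤ ‖v + t • p‖ ^ 2) : ⟪v, p⟫ = 0 := by
  rcases eq_or_ne p 0 with rfl | hp
  · simp
  have h1 := h (-(⟪v, p⟫ / ‖p‖ ^ 2))
  rw [norm_sq_add_smul_optimal v hp] at h1
  have h2 : 0 < ‖p‖ ^ 2 := by positivity
  have h3 : ⟪v, p⟫ ^ 2 / ‖p‖ ^ 2 ≤ 0 := by linarith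
  have h4 : ⟪v, p⟫ ^ 2 ≤ 0 := by
    by_contra! hc
    exact absurd (div_pos hc h2) (not_lt.2 h3)
  exact pow_eq_zero_iff two_ne_zero |>.1 (le_antisymm h4 (sq_nonneg _))

end LeastSquares

/-! ### The scalar potential -/

/-- A concave function that grows linearly up to `1` and saturates at `2`. -/
noncomputable def saturate (e : ℝ) : ℝ := if e ≤ 1 then e else 2 - 1 / e

theorem saturate_nonneg {e : ℝ} (he : 0 ≤ e) : 0 ≤ saturate e := by
  unfold saturate
  split_ifs with h
  · exact he
  · have : 1 / e ≤ 1 := by rw [div_le_one (by linarith)]; linarith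
    linarith

theorem saturate_le_two (e : ℝ) : saturate e ≤ 2 := by
  unfold saturate
  split_ifs with h
  · linarith
  · have : 0 < 1 / e := by apply one_div_pos.2; linarith
    linarith

/-- The tangent inequality of the concave function `saturate`. -/
theorem saturate_sub_le {e e' : ℝ} (h : e' ≤ e) :
    (e - e') / max 1 e ^ 2 ≤ saturate e - saturate e' := by
  unfold saturate
  split_ifs with h1 h2 h2
  · rw [max_eq_left h1]; simp
  · linarith
  · push Not at h1
    rw [max_eq_right h1.le, div_le_iff₀ (by positivity)]
    have h3 : (2 - 1 / e - e') * e ^ 2 = 2 * e ^ 2 - e - e' * e ^ 2 := by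
      field_simp
    rw [h3]
    -- The difference of the two sides is (1 - e') (e² - 1) + (e - 1)².
    nlinarith [mul_nonneg (sub_nonneg.2 h2) (by nlinarith : 0 ≤ e ^ 2 - 1), sq_nonneg (e - 1)]
  · push Not at h1 h2
    rw [max_eq_right h1.le]
    have h3 : 2 - 1 / e - (2 - 1 / e') = (e - e') / (e * e') := by
      field_simp
      ring
    rw [h3]
    apply div_le_div_of_nonneg_left (by linarith) (by positivity)
    nlinarith

theorem saturate_mono {e e' : ℝ} (h : e' ≤ e) : saturate e' ≤ saturate e := by
  have h1 := saturate_sub_le h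
  have h2 : 0 ≤ (e - e') / max 1 e ^ 2 := div_nonneg (by linarith) (by positivity)
  linarith

/-- A bound, up to a constant, for the number of decreases by at least `g ^ 2 / R` that are
possible from the value `ε`, if `g` never falls below `δ` nor below `ε / A`. -/
noncomputable def potential (A R δ ε : ℝ) : ℝ := A * R / δ * saturate (ε / (A * δ))

section Potential

variable {A R δ : ℝ} (hA : 0 < A) (hR : 0 < R) (hδ : 0 < δ)
include hA hR hδ

theorem potential_nonneg {ε : ℝ} (h : 0 ≤ ε) : 0 ≤ potential A R δ ε :=
  mul_nonneg (by positivity) (saturate_nonneg (by positivity))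

theorem potential_le (ε : ℝ) : potential A R δ ε ≤ 2 * (A * R / δ) := by
  unfold potential
  nlinarith [saturate_le_two (ε / (A * δ)), (by positivity : 0 ≤ A * R / δ)]

theorem potential_mono {ε ε' : ℝ} (h : ε' ≤ ε) : potential A R δ ε' ≤ potential A R δ ε :=
  mul_le_mul_of_nonneg_left (saturate_mono (by gcongr)) (by positivity)

/-- With e = ε / (A δ), both lower bounds on g say g ≥ δ max(1, e). So e falls by at least (δ / (A
R)) max(1, e)², and the tangent inequality cancels the square. -/
theorem potential_add_one_le {ε ε' g : ℝ} (hg : δ ≤ g) (hε : ε ≤ g * A)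
    (h : ε' ≤ ε - g ^ 2 / R) : potential A R δ ε' + 1 ≤ potential A R δ ε := by
  have hg0 : 0 < g := hδ.trans_le hg
  have hle : ε' ≤ ε := h.trans (by linarith [(by positivity : 0 ≤ g ^ 2 / R)])
  have h1 := saturate_sub_le (e := ε / (A * δ)) (e' := ε' / (A * δ)) (by gcongr)
  have h2 : max 1 (ε / (A * δ)) ≤ g / δ := by
    apply max_le
    · rwa [one_le_div hδ]
    · rw [div_le_div_iff₀ (by positivity) hδ]; nlinarith
  have h3 : δ / (A * R) ≤ (ε / (A * δ) - ε' / (A * δ)) / max 1 (ε / (A * δ)) ^ 2 := by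
    have h4 : max 1 (ε / (A * δ)) ^ 2 ≤ (g / δ) ^ 2 := by
      apply pow_le_pow_left₀ _ h2
      exact zero_le_one.trans (le_max_left _ _)
    rw [le_div_iff₀ (by positivity)]
    calc δ / (A * R) * max 1 (ε / (A * δ)) ^ 2 ≤ δ / (A * R) * (g / δ) ^ 2 := by gcongr
      _ = g ^ 2 / R / (A * δ) := by field_simp
      _ ≤ (ε - ε') / (A * δ) := by gcongr; linarith
      _ = _ := by ring
  have h5 : A * R / δ * (δ / (A * R)) = 1 := by field_simp
  have h6 := mul_le_mul_of_nonneg_left (h3.trans h1) (by positivity : 0 ≤ A * R / δ)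
  unfold potential
  linarith

end Potential

/-! ### The Euclidean model of the problem -/

section Model

variable {N : ℕ}

/-- The isometry of `ℝ^N × ℝ`, with the inner product of `W` on the first factor, onto a Euclidean
space. -/
noncomputable def embed (w : Fin N → ℝ) :
    ((Fin N → ℝ) × ℝ) →ₗ[ℝ] WithLp 2 (EuclideanSpace ℝ (Fin N) × ℝ) where
  toFun p := WithLp.toLp 2 (WithLp.toLp 2 fun i => √(w i) * p.1 i, p.2)
  map_add' p q := by
    rw [← WithLp.toLp_add]
    congr 1
    ext i
    · simp [mul_add]
    · simp
  map_smul' t p := by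
    rw [RingHom.id_apply, ← WithLp.toLp_smul]
    congr 1
    ext i
    · simp; ring
    · simp

/-- The generator `(q, 1)` of the cone. -/
noncomputable def gen (w q : Fin N → ℝ) : WithLp 2 (EuclideanSpace ℝ (Fin N) × ℝ) :=
  embed w (q, 1)

/-- The point `(a, 0)` to be approximated. -/
noncomputable def target (w a : Fin N → ℝ) : WithLp 2 (EuclideanSpace ℝ (Fin N) × ℝ) :=
  embed w (a, 0)

/-- The combination `∑_{q ∈ S} α_q (q, 1)` of generators. -/
noncomputable def genComb (w : Fin N → ℝ) (S : Finset (Fin N → ℝ)) (α : (Fin N → ℝ) → ℝ) :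
    WithLp 2 (EuclideanSpace ℝ (Fin N) × ℝ) :=
  ∑ q ∈ S, α q • gen w q

theorem genComb_eq_embed (w : Fin N → ℝ) (S : Finset (Fin N → ℝ)) (α : (Fin N → ℝ) → ℝ) :
    genComb w S α = embed w (comb S α, total S α) := by
  have : ((comb S α, total S α) : (Fin N → ℝ) × ℝ) = ∑ q ∈ S, α q • (q, (1 : ℝ)) := by
    ext i <;> simp [comb, total, Prod.fst_sum, Prod.snd_sum]
  simp only [this, genComb, gen, map_sum, map_smul]

theorem genComb_sub (w : Fin N → ℝ) (S : Finset (Fin N → ℝ)) (α β : (Fin N → ℝ) → ℝ) :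
    genComb w S α - genComb w S β = genComb w S (α - β) := by
  simp [genComb, sub_smul]

theorem inner_genComb (w : Fin N → ℝ) (S : Finset (Fin N → ℝ)) (α : (Fin N → ℝ) → ℝ)
    (v : WithLp 2 (EuclideanSpace ℝ (Fin N) × ℝ)) :
    ⟪v, genComb w S α⟫ = ∑ q ∈ S, α q * ⟪v, gen w q⟫ := by
  simp [genComb, inner_sum, inner_smul_right]

theorem genComb_add_single (w : Fin N → ℝ) {S : Finset (Fin N → ℝ)} (α : (Fin N → ℝ) → ℝ)
    {p : Fin N → ℝ} (hp : p ∈ S) (t : ℝ) :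
    genComb w S (α + Pi.single p t) = genComb w S α + t • gen w p := by
  simp [genComb, add_smul, Finset.sum_add_distrib, Pi.single_apply, ite_smul, hp]

theorem comb_subset {S T : Finset (Fin N → ℝ)} {α : (Fin N → ℝ) → ℝ} (h : T ⊆ S)
    (h0 : ∀ q ∈ S, q ∉ T → α q = 0) : comb T α = comb S α :=
  Finset.sum_subset h fun q hq hq' => by simp [h0 q hq hq']

theorem total_subset {S T : Finset (Fin N → ℝ)} {α : (Fin N → ℝ) → ℝ} (h : T ⊆ S)
    (h0 : ∀ q ∈ S, q ∉ T → α q = 0) : total T α = total S α :=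
  Finset.sum_subset h h0

theorem gen_ne_zero (w q : Fin N → ℝ) : gen w q ≠ 0 := by
  intro h
  have := congrArg (fun v => (WithLp.ofLp v).2) h
  simp [gen, embed] at this

variable {w : Fin N → ℝ} (hw : ∀ i, 0 < w i)
include hw

theorem inner_embed (u v : (Fin N → ℝ) × ℝ) :
    ⟪embed w u, embed w v⟫ = wInner w u.1 v.1 + u.2 * v.2 := by
  rw [WithLp.prod_inner_apply]
  simp only [embed, LinearMap.coe_mk, AddHom.coe_mk, PiLp.inner_apply, wInner]
  congr 1
  · refine Finset.sum_congr rfl fun i _ => ?_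
    have := Real.mul_self_sqrt (hw i).le
    simp only [RCLike.inner_apply, conj_trivial]
    calc _ = (√(w i) * √(w i)) * u.1 i * v.1 i := by ring
      _ = _ := by rw [this]
  · simp [mul_comm]

theorem wNorm_sq (x : Fin N → ℝ) : wNorm w x ^ 2 = wInner w x x := by
  rw [wNorm, Real.sq_sqrt (Finset.sum_nonneg fun i _ => mul_nonneg (hw i).le (sq_nonneg _)), wInner]
  exact Finset.sum_congr rfl fun i _ => by ring

theorem norm_sq_embed (u : (Fin N → ℝ) × ℝ) : ‖embed w u‖ ^ 2 = wNorm w u.1 ^ 2 + u.2 ^ 2 := by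
  rw [← real_inner_self_eq_norm_sq, inner_embed hw, wNorm_sq hw, sq u.2]

theorem norm_sq_gen (q : Fin N → ℝ) : ‖gen w q‖ ^ 2 = 1 + wNorm w q ^ 2 := by
  rw [gen, norm_sq_embed hw]; ring

theorem norm_sq_target (a : Fin N → ℝ) : ‖target w a‖ ^ 2 = wNorm w a ^ 2 := by
  rw [target, norm_sq_embed hw]; ring

omit hw in
theorem embed_sub_target (w a y : Fin N → ℝ) (φ : ℝ) :
    embed w (y, φ) - target w a = embed w (y - a, φ) := by
  rw [target, ← map_sub]; simp

theorem obj_eq (a y : Fin N → ℝ) (φ : ℝ) :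
    obj w a y φ = ‖embed w (y, φ) - target w a‖ ^ 2 := by
  rw [embed_sub_target, norm_sq_embed hw, obj]

theorem obj_comb (a : Fin N → ℝ) (S : Finset (Fin N → ℝ)) (α : (Fin N → ℝ) → ℝ) :
    obj w a (comb S α) (total S α) = ‖genComb w S α - target w a‖ ^ 2 := by
  rw [obj_eq hw, genComb_eq_embed]

theorem inner_residual_gen (a y q : Fin N → ℝ) (φ : ℝ) :
    ⟪embed w (y, φ) - target w a, gen w q⟫ = wInner w (y - a) q + φ := by
  rw [embed_sub_target, gen, inner_embed hw]; simp

theorem wInner_le (x y : Fin N → ℝ) : |wInner w x y| ≤ wNorm w x * wNorm w y := by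
  have h := abs_real_inner_le_norm (embed w (x, 0)) (embed w (y, 0))
  have hn : ∀ z : Fin N → ℝ, ‖embed w (z, 0)‖ = wNorm w z := fun z => by
    refine (sq_eq_sq₀ (norm_nonneg _) (Real.sqrt_nonneg _)).1 ?_
    rw [norm_sq_embed hw]; simp [wNorm]
  rw [inner_embed hw, hn, hn] at h
  simpa using h

/-! ### Minimizers of the least squares problem -/

section Argmin

variable {a : Fin N → ℝ} {S : Finset (Fin N → ℝ)} {α : (Fin N → ℝ) → ℝ}

theorem IsArgmin.inner_gen_eq_zero (h : IsArgmin w a S α) {q : Fin N → ℝ} (hq : q ∈ S) :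
    ⟪genComb w S α - target w a, gen w q⟫ = 0 := by
  refine inner_eq_zero_of_forall_norm_sq_le fun t => ?_
  have := h.2 (α + Pi.single q t)
  rw [obj_comb hw, obj_comb hw, genComb_add_single w α hq] at this
  rwa [add_sub_right_comm] at this

theorem IsArgmin.inner_genComb_eq_zero (h : IsArgmin w a S α) (β : (Fin N → ℝ) → ℝ) :
    ⟪genComb w S α - target w a, genComb w S β⟫ = 0 := by
  rw [inner_genComb]
  exact Finset.sum_eq_zero fun q hq => by rw [h.inner_gen_eq_zero hw hq, mul_zero]

/-- Changing only the coefficient of p, by the optimal step of a line search from β, already gains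
this much. -/
theorem IsArgmin.le_sub_sq (h : IsArgmin w a S α) (β : (Fin N → ℝ) → ℝ) {p : Fin N → ℝ}
    (hp : p ∈ S) :
    obj w a (comb S α) (total S α) ≤ obj w a (comb S β) (total S β) -
      ⟪genComb w S β - target w a, gen w p⟫ ^ 2 / ‖gen w p‖ ^ 2 := by
  refine (h.2 (β + Pi.single p
    (-(⟪genComb w S β - target w a, gen w p⟫ / ‖gen w p‖ ^ 2)))).trans_eq ?_
  rw [obj_comb hw, obj_comb hw, genComb_add_single w β hp,
    ← norm_sq_add_smul_optimal _ (gen_ne_zero w p)]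
  congr 2
  abel

/-- The objective along the segment from `β` to a minimizer `α`. -/
theorem IsArgmin.norm_sq_segment (h : IsArgmin w a S α) (β : (Fin N → ℝ) → ℝ) (θ : ℝ) :
    obj w a (comb S (θ • α + (1 - θ) • β)) (total S (θ • α + (1 - θ) • β)) =
      obj w a (comb S α) (total S α) +
        (1 - θ) ^ 2 * (obj w a (comb S β) (total S β) - obj w a (comb S α) (total S α)) := by
  -- Pythagoras: the residual at α is orthogonal to the span of the generators, so the excess over
  -- the minimum is a squared distance, which scales by (1 - θ)² on the segment.
  have key : ∀ γ : (Fin N → ℝ) → ℝ, obj w a (comb S γ) (total S γ) =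
      obj w a (comb S α) (total S α) + ‖genComb w S (γ - α)‖ ^ 2 := fun γ => by
    rw [obj_comb hw, obj_comb hw]
    have : genComb w S γ - target w a = (genComb w S α - target w a) + genComb w S (γ - α) := by
      rw [← genComb_sub]; abel
    rw [this, norm_add_sq_real, h.inner_genComb_eq_zero hw]; ring
  rw [key (θ • α + (1 - θ) • β), key β]
  have : genComb w S (θ • α + (1 - θ) • β - α) = (1 - θ) • genComb w S (β - α) := by
    simp only [genComb, Finset.smul_sum, smul_smul]
    refine Finset.sum_congr rfl fun q _ => ?_
    congr 1
    simp; ring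
  rw [this, norm_smul, mul_pow, Real.norm_eq_abs, sq_abs]
  ring

variable (a S) in
-- The orthogonal projection of the target onto the span of the generators; these may be linearly
-- dependent, so the coefficients need not be unique.
theorem exists_isArgmin : ∃ α, IsArgmin w a S α := by
  classical
  let K := Submodule.span ℝ (gen w '' (S : Set (Fin N → ℝ)))
  have hK : FiniteDimensional ℝ K := inferInstance
  obtain ⟨c, hc⟩ := Submodule.mem_span_image_finset_iff_exists_fun' ℝ |>.1
    (K.starProjection_apply_mem (target w a))
  let α : (Fin N → ℝ) → ℝ := fun q => if q ∈ S then c q else 0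
  have hα : genComb w S α = K.starProjection (target w a) := by
    rw [← hc]
    exact Finset.sum_congr rfl fun q hq => by simp [α, hq]
  refine ⟨α, fun q hq => by simp [α, hq], fun β => ?_⟩
  rw [obj_comb hw, obj_comb hw]
  have h1 : genComb w S (β - α) ∈ K := Submodule.sum_mem _ fun q hq =>
    K.smul_mem _ (Submodule.subset_span ⟨q, hq, rfl⟩)
  have h2 : genComb w S β - target w a = genComb w S (β - α) -
      (target w a - genComb w S α) := by rw [← genComb_sub]; abel
  have h3 : ⟪target w a - genComb w S α, genComb w S (β - α)⟫ = 0 := by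
    rw [hα]; exact K.starProjection_inner_eq_zero _ _ h1
  rw [h2, norm_sub_sq_real (genComb w S (β - α)), real_inner_comm, h3, norm_sub_rev]
  nlinarith [sq_nonneg ‖genComb w S (β - α)‖]

end Argmin

/-! ### Cone and optimality gap -/

omit hw in
theorem continuous_wNorm (w : Fin N → ℝ) : Continuous (wNorm w) := by
  unfold wNorm; fun_prop

omit hw in
theorem continuous_wInner_right (w x : Fin N → ℝ) : Continuous (wInner w x) := by
  unfold wInner; fun_prop

omit hw in
theorem IsPolytope.isCompact {B : Set (Fin N → ℝ)} (hB : IsPolytope B) : IsCompact B := by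
  obtain ⟨V, -, rfl⟩ := hB
  exact V.finite_toSet.isCompact_convexHull (𝕜 := ℝ)

omit hw in
theorem IsPolytope.convex {B : Set (Fin N → ℝ)} (hB : IsPolytope B) : Convex ℝ B := by
  obtain ⟨V, -, rfl⟩ := hB
  exact convex_convexHull ℝ _

omit hw in
theorem exists_isOracle (w a y : Fin N → ℝ) {B : Set (Fin N → ℝ)} (hB : IsCompact B)
    (hne : B.Nonempty) : ∃ q, IsOracle w a B y q := by
  obtain ⟨q, hq, h⟩ := hB.exists_isMinOn hne (continuous_wInner_right w (gradY a y)).continuousOn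
  exact ⟨q, hq, fun p hp => h hp⟩

omit hw in
theorem IsOracle.inner_le {w a y q : Fin N → ℝ} {B : Set (Fin N → ℝ)} (h : IsOracle w a B y q)
    {p : Fin N → ℝ} (hp : p ∈ B) : wInner w (y - a) q ≤ wInner w (y - a) p := by
  have h1 := h.2 p hp
  have h2 : ∀ z, wInner w (gradY a y) z = 2 * wInner w (y - a) z := fun z => by
    rw [wInner, wInner, Finset.mul_sum]
    exact Finset.sum_congr rfl fun i _ => by simp [gradY]; ring
  rw [h2, h2] at h1
  linarith

omit hw in
theorem wNorm_le_maxNorm (w : Fin N → ℝ) {B : Set (Fin N → ℝ)} (hB : IsCompact B) {q : Fin N → ℝ}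
    (hq : q ∈ B) : wNorm w q ≤ maxNorm w B :=
  le_csSup (hB.image (continuous_wNorm w)).bddAbove ⟨q, hq, rfl⟩

omit hw in
theorem comb_mem_inducedCone {B : Set (Fin N → ℝ)} (hB : Convex ℝ B) (hne : B.Nonempty)
    {S : Finset (Fin N → ℝ)} {α : (Fin N → ℝ) → ℝ} (hS : ∀ q ∈ S, q ∈ B)
    (hα : ∀ q ∈ S, 0 ≤ α q) : (comb S α, total S α) ∈ inducedCone B := by
  have h0 : 0 ≤ total S α := Finset.sum_nonneg hα
  refine ⟨?_, h0⟩
  rcases h0.eq_or_lt with h | h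
  · have : comb S α = 0 := Finset.sum_eq_zero fun q hq => by
      rw [(Finset.sum_eq_zero_iff_of_nonneg hα).1 h.symm q hq, zero_smul]
    simp only [this, ← h]
    rw [Set.zero_smul_set hne]
    exact Set.mem_zero.2 rfl
  · refine ⟨∑ q ∈ S, (α q / total S α) • q, hB.sum_mem (fun q hq => div_nonneg (hα q hq) h0) ?_ hS,
      ?_⟩
    · rw [← Finset.sum_div]; exact div_self h.ne'
    · simp only [Finset.smul_sum, smul_smul]
      exact Finset.sum_congr rfl fun q _ => by rw [mul_div_cancel₀ _ h.ne']

omit hw in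
theorem obj_nonneg (w a y : Fin N → ℝ) (φ : ℝ) : 0 ≤ obj w a y φ := by
  unfold obj; positivity

omit hw in
theorem optVal_le (w a : Fin N → ℝ) {B : Set (Fin N → ℝ)} {y : Fin N → ℝ} {φ : ℝ}
    (hp : (y, φ) ∈ inducedCone B) : optVal w a B ≤ obj w a y φ := by
  refine csInf_le ⟨0, ?_⟩ ⟨(y, φ), hp, rfl⟩
  rintro _ ⟨u, -, rfl⟩
  exact obj_nonneg _ _ _ _

/-- Weak duality: the stopping test controls the optimality gap. -/
theorem obj_sub_optVal_le {a y : Fin N → ℝ} {φ g : ℝ} {B : Set (Fin N → ℝ)} (hne : B.Nonempty)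
    (hg : 0 ≤ g)
    (horth : ⟪embed w (y, φ) - target w a, embed w (y, φ)⟫ = 0)
    (hgap : ∀ p ∈ B, -g ≤ wInner w (y - a) p + φ) :
    obj w a y φ - optVal w a B ≤ g * wNorm w a := by
  suffices h : obj w a y φ - g * wNorm w a ≤ optVal w a B by linarith
  refine le_csInf (Set.Nonempty.image _ ⟨(0, 0), ?_, le_rfl⟩) ?_
  · rw [Set.zero_smul_set hne]
    exact Set.mem_zero.2 rfl
  rintro _ ⟨⟨v, t⟩, ⟨⟨q, hq, hqv⟩, ht⟩, rfl⟩
  simp only at hqv ht ⊢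
  have hv : embed w (v, t) = t • gen w q := by
    rw [gen, ← map_smul, ← hqv]; simp
  have hA : (0 : ℝ) ≤ wNorm w a := Real.sqrt_nonneg _
  have h1 := hgap q hq
  rw [← inner_residual_gen hw, inner_sub_left] at h1
  -- The best multiple of a generator is at most ‖a‖ / 2, by 2 ‖q‖ ≤ 1 + ‖q‖². This is how ‖a‖
  -- enters the bound.
  have h2 : 2 * ⟪target w a, gen w q⟫ ≤ wNorm w a * ‖gen w q‖ ^ 2 := by
    rw [norm_sq_gen hw, target, gen, inner_embed hw]
    have := (le_abs_self _).trans (wInner_le hw a q)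
    simp only [zero_mul, add_zero]
    nlinarith [mul_nonneg hA (sq_nonneg (1 - wNorm w q))]
  rw [obj_eq hw, obj_eq hw, hv]
  generalize embed w (y, φ) = x at *
  generalize gen w q = p at *
  generalize target w a = b at *
  generalize wNorm w a = A at *
  rw [inner_sub_left, real_inner_self_eq_norm_sq, real_inner_comm] at horth
  have e1 := norm_sub_sq_real x b
  have e2 := norm_sub_sq_real (t • p) b
  rw [real_inner_smul_left, norm_smul, mul_pow, Real.norm_eq_abs, sq_abs,
    real_inner_comm] at e2
  -- By orthogonality h(x) = ‖b‖² - ‖x‖², so the right side is h(s p) - h(x). It equals ‖x - s p‖²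
  -- plus 2 s ⟨x - b, p⟩, which is at least -2 s g.
  have key : ∀ s : ℝ, 0 ≤ s → s ≤ A / 2 →
      -(g * A) ≤ ‖x‖ ^ 2 + s ^ 2 * ‖p‖ ^ 2 - 2 * s * ⟪b, p⟫ := fun s hs hsA => by
    have e3 : 0 ≤ ‖x - s • p‖ ^ 2 := sq_nonneg _
    rw [norm_sub_sq_real, real_inner_smul_right, norm_smul, mul_pow, Real.norm_eq_abs,
      sq_abs] at e3
    nlinarith [mul_le_mul_of_nonneg_left h1 hs, mul_le_mul_of_nonneg_left hsA hg]
  -- Beyond A / 2 the quadratic in t is past its vertex and increases, so t = A / 2 is the worst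
  -- case.
  have hmain : -(g * A) ≤ ‖x‖ ^ 2 + t ^ 2 * ‖p‖ ^ 2 - 2 * t * ⟪b, p⟫ := by
    rcases le_or_gt t (A / 2) with h | h
    · exact key t ht h
    · have h3 := key (A / 2) (by positivity) le_rfl
      have h4 : 0 ≤ (t - A / 2) * ((t + A / 2) * ‖p‖ ^ 2 - 2 * ⟪b, p⟫) := by
        apply mul_nonneg (by linarith)
        nlinarith [mul_nonneg (sub_nonneg.2 h.le) (sq_nonneg ‖p‖)]
      nlinarith
  rw [e1, e2]
  linarith

end Model

/-! ### Invariants of the configurations -/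

section Invariants

variable {N : ℕ}

/-- The point of the configuration is the combination of the active set that is given by its
nonnegative coefficients. -/
structure Config.Feasible (B : Set (Fin N → ℝ)) (c : Config N) : Prop where
  mem : ∀ q ∈ c.active, q ∈ B
  coeff_nonneg : ∀ q ∈ c.active, 0 ≤ c.coeff q
  coeff_eq_zero : ∀ q, q ∉ c.active → c.coeff q = 0
  point_eq : c.point = comb c.active c.coeff

/-- All coefficients on the active set are positive. -/
def Config.Positive (c : Config N) : Prop := ∀ q ∈ c.active, 0 < c.coeff q

/-- The coefficients minimize the objective over the linear span of the active set. -/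
def Config.Stationary (w a : Fin N → ℝ) (c : Config N) : Prop :=
  ∀ q ∈ c.active, wInner w (c.point - a) q + c.phi = 0

/-- The configuration is the origin, and its active set is a single point. -/
def Config.Degenerate (c : Config N) : Prop := c.active.card = 1 ∧ ∀ q, c.coeff q = 0

/-- The invariant of the reachable configurations. -/
structure Config.Invariant (w a : Fin N → ℝ) (B : Set (Fin N → ℝ)) (c : Config N) : Prop where
  feasible : c.Feasible B
  major : c.inMinor = false → c.Positive ∧ c.Stationary w a ∨ c.Degenerate
  minor : c.inMinor = true → c.Positive

namespace Config

variable {w a : Fin N → ℝ} {B : Set (Fin N → ℝ)} {c : Config N} {S : Finset (Fin N → ℝ)}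
  {α : (Fin N → ℝ) → ℝ} {θ : ℝ}

theorem Feasible.coeff_nonneg' (h : c.Feasible B) (q : Fin N → ℝ) : 0 ≤ c.coeff q := by
  by_cases hq : q ∈ c.active
  · exact h.coeff_nonneg q hq
  · exact (h.coeff_eq_zero q hq).ge

theorem Feasible.point_eq_comb (h : c.Feasible B) (hS : c.active ⊆ S) :
    c.point = comb S c.coeff := by
  rw [h.point_eq, comb_subset hS fun q _ => h.coeff_eq_zero q]

theorem Feasible.phi_eq_total (h : c.Feasible B) (hS : c.active ⊆ S) :
    c.phi = total S c.coeff := by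
  rw [phi, total_subset hS fun q _ => h.coeff_eq_zero q]

theorem Feasible.value_eq (h : c.Feasible B) (hS : c.active ⊆ S) :
    c.value w a = obj w a (comb S c.coeff) (total S c.coeff) := by
  rw [value, h.point_eq_comb hS, h.phi_eq_total hS]

theorem Feasible.mem_inducedCone (h : c.Feasible B) (hB : Convex ℝ B) (hne : B.Nonempty) :
    (c.point, c.phi) ∈ inducedCone B := by
  rw [h.point_eq]
  exact comb_mem_inducedCone hB hne h.mem h.coeff_nonneg

theorem Feasible.phi_nonneg (h : c.Feasible B) : 0 ≤ c.phi := Finset.sum_nonneg h.coeff_nonneg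

/-! ### The end of a major loop -/

theorem comb_closeMajor (hα : ∀ q ∈ S, 0 ≤ α q) : comb (closeMajor S α).active α = comb S α := by
  refine comb_subset (Finset.filter_subset _ _) fun q hq hq' => ?_
  simp only [closeMajor, Finset.mem_filter, hq, true_and, not_lt] at hq'
  exact le_antisymm hq' (hα q hq)

theorem phi_closeMajor (hα : ∀ q ∈ S, 0 ≤ α q) : (closeMajor S α).phi = total S α := by
  refine total_subset (Finset.filter_subset _ _) fun q hq hq' => ?_
  simp only [closeMajor, Finset.mem_filter, hq, true_and, not_lt] at hq'
  exact le_antisymm hq' (hα q hq)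

theorem value_closeMajor (hα : ∀ q ∈ S, 0 ≤ α q) :
    (closeMajor S α).value w a = obj w a (comb S α) (total S α) := by
  rw [value, phi_closeMajor hα]; rfl

theorem card_closeMajor : (closeMajor S α).active.card ≤ S.card := Finset.card_filter_le _ _

theorem invariant_closeMajor (hw : ∀ i, 0 < w i) (hS : ∀ q ∈ S, q ∈ B) (h : IsArgmin w a S α)
    (hα : ∀ q ∈ S, 0 ≤ α q) : (closeMajor S α).Invariant w a B where
  feasible :=
    { mem := fun q hq => hS q (Finset.mem_filter.1 hq).1
      coeff_nonneg := fun q hq => (Finset.mem_filter.1 hq).2.le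
      coeff_eq_zero := fun q hq => by
        by_cases hq' : q ∈ S
        · simp only [closeMajor, Finset.mem_filter, hq', true_and, not_lt] at hq
          exact le_antisymm hq (hα q hq')
        · exact h.1 q hq'
      point_eq := (comb_closeMajor hα).symm }
  major := fun _ => Or.inl ⟨fun q hq => (Finset.mem_filter.1 hq).2, fun q hq => by
    rw [phi_closeMajor hα, ← inner_residual_gen hw]
    have := h.inner_gen_eq_zero hw (Finset.mem_filter.1 hq).1
    rwa [genComb_eq_embed] at this⟩
  minor := fun h => by simp [closeMajor] at h

/-! ### A pass of the minor loop -/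

section CloseMinor

variable (hc : c.Feasible B) (hθ : IsRatio S c.coeff α θ)
include hc hθ

theorem ratio_mem : 0 ≤ θ ∧ θ < 1 := by
  obtain ⟨q, -, hq, rfl⟩ := hθ.1
  have := hc.coeff_nonneg' q
  refine ⟨div_nonneg this (by linarith), ?_⟩
  rw [div_lt_one (by linarith)]
  linarith

theorem closeMinor_coeff_nonneg {q : Fin N → ℝ} (hq : q ∈ S) :
    0 ≤ θ * α q + (1 - θ) * c.coeff q := by
  have h0 := hc.coeff_nonneg' q
  obtain ⟨h1, h2⟩ := ratio_mem hc hθ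
  rcases le_or_gt 0 (α q) with h | h
  · exact add_nonneg (mul_nonneg h1 h) (mul_nonneg (by linarith) h0)
  · have := hθ.2 ⟨q, hq, h, rfl⟩
    rw [le_div_iff₀ (by linarith)] at this
    linarith

theorem closeMinor_coeff_eq_zero {q : Fin N → ℝ} (hq : q ∈ S)
    (hq' : q ∉ (closeMinor c S α θ).active) : θ * α q + (1 - θ) * c.coeff q = 0 := by
  simp only [closeMinor, Finset.mem_filter, hq, true_and, not_lt] at hq'
  exact le_antisymm hq' (closeMinor_coeff_nonneg hc hθ hq)

omit hθ in
theorem comb_closeMinor (hS : c.active ⊆ S) :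
    (closeMinor c S α θ).point = comb S (θ • α + (1 - θ) • c.coeff) := by
  simp [closeMinor, hc.point_eq_comb hS, comb, add_smul, Finset.sum_add_distrib, mul_smul,
    Finset.smul_sum]

theorem phi_closeMinor : (closeMinor c S α θ).phi = total S (θ • α + (1 - θ) • c.coeff) :=
  total_subset (Finset.filter_subset _ _) fun _ hq hq' => closeMinor_coeff_eq_zero hc hθ hq hq'

theorem invariant_closeMinor (hS : c.active ⊆ S) (hSB : ∀ q ∈ S, q ∈ B)
    (h : IsArgmin w a S α) : (closeMinor c S α θ).Invariant w a B where
  feasible :=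
    { mem := fun q hq => hSB q (Finset.mem_filter.1 hq).1
      coeff_nonneg := fun q hq => (Finset.mem_filter.1 hq).2.le
      coeff_eq_zero := fun q hq => by
        by_cases hq' : q ∈ S
        · exact closeMinor_coeff_eq_zero hc hθ hq' hq
        · simp [closeMinor, h.1 q hq', hc.coeff_eq_zero q fun hn => hq' (hS hn)]
      point_eq := by
        rw [comb_closeMinor hc hS]
        exact (comb_subset (Finset.filter_subset _ _) fun _ hq hq' =>
          closeMinor_coeff_eq_zero hc hθ hq hq').symm }
  major := fun h => by simp [closeMinor] at h
  minor := fun _ q hq => (Finset.mem_filter.1 hq).2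

theorem value_closeMinor (hw : ∀ i, 0 < w i) (hS : c.active ⊆ S) (h : IsArgmin w a S α) :
    (closeMinor c S α θ).value w a = obj w a (comb S α) (total S α) +
      (1 - θ) ^ 2 * (c.value w a - obj w a (comb S α) (total S α)) := by
  rw [hc.value_eq hS, ← h.norm_sq_segment hw, value, comb_closeMinor hc hS,
    phi_closeMinor hc hθ]

/-- The index attaining the minimal ratio gets coefficient exactly 0 and is dropped. -/
theorem card_closeMinor : (closeMinor c S α θ).active.card + 1 ≤ S.card := by
  obtain ⟨q, hq, hneg, hqθ⟩ := hθ.1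
  refine Finset.card_lt_card (Finset.filter_ssubset.2 ⟨q, hq, ?_⟩)
  have h0 := hc.coeff_nonneg' q
  have : θ * (c.coeff q - α q) = c.coeff q := by
    rw [hqθ, div_mul_cancel₀]; linarith
  linarith

theorem value_closeMinor_le (hw : ∀ i, 0 < w i) (hS : c.active ⊆ S) (h : IsArgmin w a S α) :
    (closeMinor c S α θ).value w a ≤ c.value w a := by
  have h1 := h.2 c.coeff
  rw [← hc.value_eq hS] at h1
  rw [value_closeMinor hc hθ hw hS h]
  obtain ⟨h2, h3⟩ := ratio_mem hc hθ
  nlinarith [mul_nonneg (sub_nonneg.2 h1) (by nlinarith : 0 ≤ 1 - (1 - θ) ^ 2)]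

end CloseMinor

/-! ### The start of a major loop -/

theorem Feasible.embed_eq (hc : c.Feasible B) (hS : c.active ⊆ S) :
    embed w (c.point, c.phi) = genComb w S c.coeff := by
  rw [hc.point_eq_comb hS, hc.phi_eq_total hS, genComb_eq_embed]

theorem Invariant.orthogonal (hw : ∀ i, 0 < w i) (hc : c.Invariant w a B)
    (hm : c.inMinor = false) :
    ⟪embed w (c.point, c.phi) - target w a, embed w (c.point, c.phi)⟫ = 0 := by
  nth_rw 2 [hc.feasible.embed_eq subset_rfl]
  rw [inner_genComb]
  refine Finset.sum_eq_zero fun q hq => ?_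
  rcases hc.major hm with h | h
  · rw [inner_residual_gen hw, h.2 q hq, mul_zero]
  · rw [h.2 q, zero_mul]

section MajorStart

variable {q : Fin N → ℝ} (hw : ∀ i, 0 < w i) (hc : c.Feasible B)
  (hq : wInner w (c.point - a) q + c.phi < 0) (h : IsArgmin w a (insert q c.active) α)
include hw hc h

theorem argmin_insert_le :
    obj w a (comb (insert q c.active) α) (total (insert q c.active) α) ≤
      c.value w a - (wInner w (c.point - a) q + c.phi) ^ 2 / (1 + wNorm w q ^ 2) := by
  have h1 := h.le_sub_sq hw c.coeff (Finset.mem_insert_self q _)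
  rwa [← hc.value_eq (Finset.subset_insert _ _), ← hc.embed_eq (Finset.subset_insert _ _),
    inner_residual_gen hw, norm_sq_gen hw] at h1

include hq

theorem argmin_insert_lt :
    obj w a (comb (insert q c.active) α) (total (insert q c.active) α) < c.value w a := by
  have h1 := argmin_insert_le hw hc h
  have h2 : 0 < (wInner w (c.point - a) q + c.phi) ^ 2 / (1 + wNorm w q ^ 2) :=
    div_pos (by nlinarith) (by positivity)
  linarith

/-- The residual is orthogonal to the old generators, so the first-order change of h towards α is 2
α_q (⟨y - a, q⟩ + φ). It must be negative because h drops, and the second factor is negative. -/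
theorem argmin_coeff_pos (hs : c.Stationary w a) : 0 < α q := by
  have hlt := argmin_insert_lt hw hc hq h
  have hsub := Finset.subset_insert q c.active
  have hqn : q ∉ c.active := fun hn => hq.ne (hs q hn)
  rw [hc.value_eq hsub, obj_comb hw, obj_comb hw] at hlt
  have hin : ⟪genComb w (insert q c.active) c.coeff - target w a,
      genComb w (insert q c.active) (α - c.coeff)⟫ =
        α q * (wInner w (c.point - a) q + c.phi) := by
    rw [inner_genComb, ← hc.embed_eq hsub, Finset.sum_insert hqn, Finset.sum_eq_zero, add_zero,
      inner_residual_gen hw]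
    · simp [hc.coeff_eq_zero q hqn]
    · intro p hp
      rw [inner_residual_gen hw, hs p hp, mul_zero]
  have he : genComb w (insert q c.active) α - target w a =
      (genComb w (insert q c.active) c.coeff - target w a) +
        genComb w (insert q c.active) (α - c.coeff) := by
    rw [← genComb_sub]; abel
  rw [he, norm_add_sq_real, hin] at hlt
  nlinarith [sq_nonneg ‖genComb w (insert q c.active) (α - c.coeff)‖]

/-- The blocking point is not q, whose new coefficient is positive, so it is an old point with
positive λ. -/
theorem ratio_pos (hp : c.Positive) (hs : c.Stationary w a)
    (hθ : IsRatio (insert q c.active) c.coeff α θ) : 0 < θ := by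
  obtain ⟨p, hpS, hneg, rfl⟩ := hθ.1
  have hpos := argmin_coeff_pos hw hc hq h hs
  have hpa : p ∈ c.active := by
    rcases Finset.mem_insert.1 hpS with rfl | hpa
    · linarith
    · exact hpa
  have := hp p hpa
  exact div_pos this (by linarith)

theorem value_closeMinor_lt (hp : c.Positive) (hs : c.Stationary w a)
    (hθ : IsRatio (insert q c.active) c.coeff α θ) :
    (closeMinor c (insert q c.active) α θ).value w a < c.value w a := by
  have h1 := argmin_insert_lt hw hc hq h
  have h2 := ratio_pos hw hc hq h hp hs hθ
  have h3 := (ratio_mem hc hθ).2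
  rw [value_closeMinor hc hθ hw (Finset.subset_insert _ _) h]
  nlinarith [mul_pos (sub_pos.2 h1) (by nlinarith : 0 < 1 - (1 - θ) ^ 2)]

/-- A major loop that takes a single shortened step makes as much guaranteed progress as one that
takes none. -/
theorem argmin_closeMinor_le (hp : c.Positive) (hs : c.Stationary w a)
    (hθ : IsRatio (insert q c.active) c.coeff α θ) {β : (Fin N → ℝ) → ℝ}
    (hβ : IsArgmin w a (closeMinor c (insert q c.active) α θ).active β) :
    obj w a (comb (closeMinor c (insert q c.active) α θ).active β)
        (total (closeMinor c (insert q c.active) α θ).active β) ≤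
      c.value w a - (wInner w (c.point - a) q + c.phi) ^ 2 / (1 + wNorm w q ^ 2) := by
  have hsub := Finset.subset_insert q c.active
  have hθ0 := ratio_pos hw hc hq h hp hs hθ
  have hθ1 := (ratio_mem hc hθ).2
  -- The new point survives the shortened step, so a line search along its generator is still
  -- available.
  have hqmem : q ∈ (closeMinor c (insert q c.active) α θ).active :=
    Finset.mem_filter.2 ⟨Finset.mem_insert_self _ _, add_pos_of_pos_of_nonneg
      (mul_pos hθ0 (argmin_coeff_pos hw hc hq h hs))
      (mul_nonneg (by linarith) (hc.coeff_nonneg' q))⟩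
  have h1 := hβ.le_sub_sq hw (closeMinor c (insert q c.active) α θ).coeff hqmem
  have hz : ∀ p ∈ insert q c.active, p ∉ (closeMinor c (insert q c.active) α θ).active →
      (closeMinor c (insert q c.active) α θ).coeff p = 0 := fun p hp hp' =>
    closeMinor_coeff_eq_zero hc hθ hp hp'
  have hpt : comb (closeMinor c (insert q c.active) α θ).active
      (closeMinor c (insert q c.active) α θ).coeff =
        (closeMinor c (insert q c.active) α θ).point := by
    rw [comb_closeMinor hc hsub]
    exact comb_subset (Finset.filter_subset _ _) hz
  have hv := value_closeMinor hc hθ hw hsub h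
  rw [value] at hv
  -- The product with the new generator is affine on the segment and vanishes at its end α.
  have hin : ⟪genComb w (closeMinor c (insert q c.active) α θ).active
      (closeMinor c (insert q c.active) α θ).coeff - target w a, gen w q⟫ =
        (1 - θ) * (wInner w (c.point - a) q + c.phi) := by
    have e1 := h.inner_gen_eq_zero hw (Finset.mem_insert_self q _)
    rw [genComb_eq_embed, inner_residual_gen hw] at e1
    rw [genComb_eq_embed, hpt, inner_residual_gen hw]
    change wInner w _ q + (closeMinor c (insert q c.active) α θ).phi = _
    have e2 : (closeMinor c (insert q c.active) α θ).phi =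
        θ * total (insert q c.active) α + (1 - θ) * c.phi := by
      rw [phi_closeMinor hc hθ, hc.phi_eq_total hsub]
      simp [total, Finset.sum_add_distrib, Finset.mul_sum]
    have e3 : wInner w ((closeMinor c (insert q c.active) α θ).point - a) q =
        θ * wInner w (comb (insert q c.active) α - a) q + (1 - θ) * wInner w (c.point - a) q := by
      simp only [wInner, Finset.mul_sum, ← Finset.sum_add_distrib, closeMinor]
      refine Finset.sum_congr rfl fun i _ => ?_
      simp; ring
    rw [e2, e3]
    linear_combination θ * e1
  rw [hin, norm_sq_gen hw, hpt, mul_pow] at h1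
  change _ ≤ obj w a _ (closeMinor c (insert q c.active) α θ).phi - _ at h1
  rw [hv] at h1
  have h2 := argmin_insert_le hw hc h
  have h3 : (1 - θ) ^ 2 ≤ 1 := by nlinarith
  rw [mul_div_assoc] at h1
  -- With G the full gain, the bound is (1 - (1 - θ)²) h(α) + (1 - θ)² (h - G), and h(α) ≤ h - G.
  nlinarith [mul_le_mul_of_nonneg_left h2 (by linarith : 0 ≤ 1 - (1 - θ) ^ 2)]

end MajorStart

/-- Here λ = 0 forces θ = 0. Such a step makes no progress in h, but it costs the active set its
only point. -/
theorem Degenerate.closeMinor_active_eq_empty (hd : c.Degenerate) (hθ : IsRatio S c.coeff α θ) :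
    (closeMinor c S α θ).active = ∅ := by
  obtain ⟨p, -, -, hp⟩ := hθ.1
  rw [hd.2 p, zero_div] at hp
  simp [closeMinor, hp, hd.2]

/-! ### Initialization -/

theorem initCoeff_nonneg (w a q₁ : Fin N → ℝ) : 0 ≤ initCoeff w a q₁ := le_max_right _ _

theorem invariant_initConfig (hw : ∀ i, 0 < w i) {q₁ : Fin N → ℝ} (hq : q₁ ∈ B) :
    (initConfig w a q₁).Invariant w a B where
  feasible :=
    { mem := fun q hq' => by rwa [Finset.mem_singleton.1 hq']
      coeff_nonneg := fun q hq' => by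
        simp [initConfig, Finset.mem_singleton.1 hq', initCoeff_nonneg]
      coeff_eq_zero := fun q hq' => by
        have : q ≠ q₁ := fun h => hq' (Finset.mem_singleton.2 h)
        simp [initConfig, this]
      point_eq := by simp [initConfig, comb] }
  major := fun _ => by
    rcases le_or_gt (wInner w a q₁) 0 with h | h
    · refine Or.inr ⟨rfl, fun q => ?_⟩
      have : initCoeff w a q₁ = 0 :=
        max_eq_right (div_nonpos_of_nonpos_of_nonneg h (by positivity))
      simp [initConfig, this]
    · have hpos : 0 < wInner w a q₁ / (1 + wNorm w q₁ ^ 2) := div_pos h (by positivity)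
      have he : initCoeff w a q₁ = wInner w a q₁ / (1 + wNorm w q₁ ^ 2) := max_eq_left hpos.le
      refine Or.inl ⟨fun q hq' => ?_, fun q hq' => ?_⟩
      · simp [initConfig, Finset.mem_singleton.1 hq', he, hpos]
      · rw [Finset.mem_singleton.1 hq']
        have e1 : wInner w (initCoeff w a q₁ • q₁ - a) q₁ =
            initCoeff w a q₁ * wNorm w q₁ ^ 2 - wInner w a q₁ := by
          rw [wNorm_sq hw]
          simp only [wInner, Finset.mul_sum, ← Finset.sum_sub_distrib]
          refine Finset.sum_congr rfl fun i _ => ?_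
          simp; ring
        have e2 : (initConfig w a q₁).phi = initCoeff w a q₁ := by
          simp [initConfig, phi, total]
        rw [e2]
        change wInner w (initCoeff w a q₁ • q₁ - a) q₁ + _ = 0
        rw [e1, he]
        field_simp
        ring
  minor := fun h => by simp [initConfig] at h

theorem positive_stationary_initConfig (hw : ∀ i, 0 < w i) {q₁ : Fin N → ℝ} (hq : q₁ ∈ B)
    (ha : 0 < wInner w a q₁) :
    (initConfig w a q₁).Positive ∧ (initConfig w a q₁).Stationary w a := by
  refine ((invariant_initConfig (a := a) hw hq).major rfl).resolve_right fun h => ?_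
  have h1 := h.2 q₁
  have h2 : 0 < wInner w a q₁ / (1 + wNorm w q₁ ^ 2) := div_pos ha (by positivity)
  simp only [initConfig, if_true] at h1
  exact (h2.trans_le (le_max_left _ _)).ne' h1

/-- At the start of a major loop the objective is at most its value at the origin. -/
theorem Invariant.value_le (hw : ∀ i, 0 < w i) (hc : c.Invariant w a B)
    (hm : c.inMinor = false) : c.value w a ≤ wNorm w a ^ 2 := by
  have h := hc.orthogonal hw hm
  rw [value, obj_eq hw, ← norm_sq_target hw]
  generalize embed w (c.point, c.phi) = x at *
  have h1 : ‖target w a‖ ^ 2 = ‖(x - target w a) - x‖ ^ 2 := by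
    rw [sub_sub_cancel_left, norm_neg]
  rw [h1, norm_sub_sq_real (x - target w a), h]
  nlinarith [sq_nonneg ‖x‖]

end Config

end Invariants

/-! ### Runs of the algorithm -/

section Runs

variable {N : ℕ} {w a : Fin N → ℝ} {B : Set (Fin N → ℝ)} {δ : ℝ} {c c' : Config N}
  {S : Finset (Fin N → ℝ)}

theorem Enters.subset (h : Enters w a B δ c S) : c.active ⊆ S := by
  rcases h with ⟨-, q, -, -, rfl⟩ | ⟨-, rfl⟩
  · exact Finset.subset_insert _ _
  · exact subset_rfl

theorem Enters.mem (h : Enters w a B δ c S) (hc : c.Feasible B) : ∀ q ∈ S, q ∈ B := by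
  rcases h with ⟨-, p, hp, -, rfl⟩ | ⟨-, rfl⟩
  · intro q hq
    rcases Finset.mem_insert.1 hq with rfl | hq
    · exact hp.1
    · exact hc.mem q hq
  · exact hc.mem

theorem Step.invariant (hw : ∀ i, 0 < w i) (h : Step w a B δ c c') (hc : c.Feasible B) :
    c'.Invariant w a B := by
  obtain ⟨S, α, hS, hα, ⟨h0, rfl⟩ | ⟨-, θ, hθ, rfl⟩⟩ := h
  · exact Config.invariant_closeMajor hw (hS.mem hc) hα h0
  · exact Config.invariant_closeMinor hc hθ hS.subset (hS.mem hc) hα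

theorem Step.value_le (hw : ∀ i, 0 < w i) (h : Step w a B δ c c') (hc : c.Feasible B) :
    c'.value w a ≤ c.value w a := by
  obtain ⟨S, α, hS, hα, ⟨h0, rfl⟩ | ⟨-, θ, hθ, rfl⟩⟩ := h
  · rw [Config.value_closeMajor h0, hc.value_eq hS.subset]
    exact hα.2 _
  · exact Config.value_closeMinor_le hc hθ hw hS.subset hα

theorem Step.value_lt (hw : ∀ i, 0 < w i) (hδ : 0 < δ) (h : Step w a B δ c c')
    (hc : c.Feasible B) (hm : c.inMinor = false) (hp : c.Positive) (hs : c.Stationary w a) :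
    c'.value w a < c.value w a := by
  obtain ⟨S, α, ⟨-, q, -, hq, rfl⟩ | ⟨hm', -⟩, hα, hstep⟩ := h
  · rcases hstep with ⟨h0, rfl⟩ | ⟨-, θ, hθ, rfl⟩
    · rw [Config.value_closeMajor h0]
      exact Config.argmin_insert_lt hw hc (by linarith) hα
    · exact Config.value_closeMinor_lt hw hc (by linarith) hα hp hs hθ
  · simp [hm] at hm'

/-- The algorithm never gets stuck. -/
theorem exists_step (hw : ∀ i, 0 < w i) (hB : IsCompact B) (hne : B.Nonempty)
    (h : ¬ Stops w a B δ c) : ∃ c', Step w a B δ c c' := by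
  obtain ⟨S, hS⟩ : ∃ S, Enters w a B δ c S := by
    cases hm : c.inMinor with
    | true => exact ⟨_, Or.inr ⟨hm, rfl⟩⟩
    | false =>
      obtain ⟨q, hq⟩ := exists_isOracle w a c.point hB hne
      refine ⟨_, Or.inl ⟨hm, q, hq, ?_, rfl⟩⟩
      by_contra! hcon
      exact h ⟨hm, q, hq, hcon⟩
  obtain ⟨α, hα⟩ := exists_isArgmin hw a S
  by_cases h0 : ∀ q ∈ S, 0 ≤ α q
  · exact ⟨_, S, α, hS, hα, Or.inl ⟨h0, rfl⟩⟩
  · push Not at h0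
    have hfin : {t : ℝ | ∃ q ∈ S, α q < 0 ∧ t = c.coeff q / (c.coeff q - α q)}.Finite := by
      refine ((S : Set (Fin N → ℝ)).toFinite.image
        fun q => c.coeff q / (c.coeff q - α q)).subset ?_
      rintro _ ⟨q, hq, -, rfl⟩
      exact ⟨q, hq, rfl⟩
    obtain ⟨q, hq, hneg⟩ := h0
    obtain ⟨θ, hθ⟩ := hfin.exists_minimal ⟨_, q, hq, hneg, rfl⟩
    have hle : IsRatio S c.coeff α θ := ⟨hθ.1, fun t ht => by
      rcases le_total θ t with h | h
      · exact h
      · exact hθ.2 ht h⟩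
    exact ⟨_, S, α, hS, hα, Or.inr ⟨⟨q, hq, hneg⟩, θ, hle, rfl⟩⟩

theorem IsRun.invariant (hw : ∀ i, 0 < w i) {q₁ : Fin N → ℝ} (hq : q₁ ∈ B) {K : ℕ}
    {c : ℕ → Config N} (h : IsRun w a B δ q₁ K c) : ∀ k ≤ K, (c k).Invariant w a B := by
  intro k hk
  cases k with
  | zero => rw [h.1]; exact Config.invariant_initConfig hw hq
  | succ k =>
    induction k with
    | zero =>
      refine (h.2 0 hk).invariant hw ?_
      rw [h.1]
      exact (Config.invariant_initConfig hw hq).feasible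
    | succ k ih => exact (h.2 (k + 1) hk).invariant hw (ih (by omega)).feasible

/-- Confines the degenerate case to k = 0, which is why strict decrease can fail only there. -/
theorem Step.positive_stationary (hw : ∀ i, 0 < w i) (h : Step w a B δ c c') (hc : c.Feasible B)
    (hm : c'.inMinor = false) : c'.Positive ∧ c'.Stationary w a := by
  obtain ⟨S, α, hS, hα, ⟨h0, rfl⟩ | ⟨-, θ, hθ, rfl⟩⟩ := h
  · have hI := Config.invariant_closeMajor hw (hS.mem hc) hα h0
    have hp : (closeMajor S α).Positive := fun q hq => (Finset.mem_filter.1 hq).2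
    refine (hI.major rfl).resolve_right fun hd => ?_
    obtain ⟨q, hq⟩ := Finset.card_pos.1 (hd.1 ▸ Nat.one_pos)
    exact (hp q hq).ne' (hd.2 q)
  · simp [closeMinor] at hm

theorem sub_optVal_le_of_stops (hw : ∀ i, 0 < w i) (hne : B.Nonempty) (hδ : 0 < δ)
    (hc : c.Invariant w a B) (h : Stops w a B δ c) :
    c.value w a - optVal w a B ≤ δ * wNorm w a := by
  obtain ⟨hm, q, hq, hqδ⟩ := h
  exact obj_sub_optVal_le hw hne hδ.le (hc.orthogonal hw hm)
    fun p hp => by linarith [hq.inner_le hp]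

/-! ### The number of iterations -/

/-- The potential of an objective value. -/
noncomputable def valuePotential (w a : Fin N → ℝ) (B : Set (Fin N → ℝ)) (δ v : ℝ) : ℝ :=
  potential (wNorm w a) (1 + maxNorm w B ^ 2) δ (v - optVal w a B)

theorem one_add_maxNorm_sq_pos : 0 < 1 + maxNorm w B ^ 2 := by positivity

theorem valuePotential_mono (hA : 0 < wNorm w a) (hδ : 0 < δ) {v v' : ℝ} (h : v' ≤ v) :
    valuePotential w a B δ v' ≤ valuePotential w a B δ v :=
  potential_mono hA one_add_maxNorm_sq_pos hδ (by linarith)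

/-- The oracle point minimizes the residual product over B, so its value -g bounds all of them and
weak duality applies with this g. -/
theorem valuePotential_add_one_le (hw : ∀ i, 0 < w i) (hB : IsCompact B) (hA : 0 < wNorm w a)
    (hδ : 0 < δ) (hc : c.Invariant w a B) (hm : c.inMinor = false) {q : Fin N → ℝ}
    (hq : IsOracle w a B c.point q) (hqδ : wInner w (c.point - a) q + c.phi < -δ) {v : ℝ}
    (hv : v ≤ c.value w a - (wInner w (c.point - a) q + c.phi) ^ 2 / (1 + wNorm w q ^ 2)) :
    valuePotential w a B δ v + 1 ≤ valuePotential w a B δ (c.value w a) := by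
  refine potential_add_one_le hA one_add_maxNorm_sq_pos hδ
    (g := -(wInner w (c.point - a) q + c.phi)) (by linarith)
    (obj_sub_optVal_le hw ⟨q, hq.1⟩ (by linarith) (hc.orthogonal hw hm)
      fun p hp => by linarith [hq.inner_le hp]) ?_
  have h1 : wNorm w q ^ 2 ≤ maxNorm w B ^ 2 :=
    pow_le_pow_left₀ (Real.sqrt_nonneg _) (wNorm_le_maxNorm w hB hq.1) 2
  have h2 : (wInner w (c.point - a) q + c.phi) ^ 2 / (1 + maxNorm w B ^ 2) ≤
      (wInner w (c.point - a) q + c.phi) ^ 2 / (1 + wNorm w q ^ 2) := by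
    gcongr
  rw [neg_sq]
  linarith

/-- The amortized bound for the counter `k` of a configuration: the size of the active set pays for
the passes of the minor loops, and the potential pays for the major loops that have at most one
shortened step. Within a major loop, `s` is the counter at its start, `n` the number of shortened
steps, `m` the size of the active set and `e` the potential at its start. -/
def WithinBudget (w a : Fin N → ℝ) (B : Set (Fin N → ℝ)) (δ b : ℝ) (k : ℕ) (c : Config N) : Prop :=
  (c.inMinor = false ∧ k + 3 * c.active.card + 4 * valuePotential w a B δ (c.value w a) ≤ b) ∨
  (c.inMinor = true ∧ ∃ (s n m : ℕ) (e : ℝ), 1 ≤ n ∧ k = s + n ∧ c.active.card + n ≤ m + 1 ∧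
    s + 3 * m + 4 * e ≤ b ∧ valuePotential w a B δ (c.value w a) ≤ e ∧
    (2 ≤ n ∨
      (∀ α, IsArgmin w a c.active α →
        valuePotential w a B δ (obj w a (comb c.active α) (total c.active α)) + 1 ≤ e) ∨
      (c.active.card = 0 ∧ m = 1)))

/-- A MAJOR loop with n shortened steps advances k by n + 1 and enlarges the active set by at most 1
- n, so k + 3 |S| grows by at most 4 - 2 n. For n ≤ 1 a unit drop of the potential, with weight 4,
pays; for n ≥ 2 nothing is owed. A shortened step from the degenerate start is paid by emptying the
active set. -/
theorem WithinBudget.step (hw : ∀ i, 0 < w i) (hB : IsCompact B) (hA : 0 < wNorm w a)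
    (hδ : 0 < δ) (hc : c.Invariant w a B) {b : ℝ} {k : ℕ} (hk : WithinBudget w a B δ b k c)
    (h : Step w a B δ c c') : WithinBudget w a B δ b (k + 1) c' := by
  have hle := valuePotential_mono (B := B) hA hδ (h.value_le hw hc.feasible)
  obtain ⟨S, α, ⟨hm, q, hq, hqδ, rfl⟩ | ⟨hm, rfl⟩, hα, hstep⟩ := h
  · obtain ⟨-, hk⟩ := hk.resolve_right (by simp [hm])
    have hcard := Finset.card_insert_le q c.active
    rcases hstep with ⟨h0, rfl⟩ | ⟨-, θ, hθ, rfl⟩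
    · refine Or.inl ⟨rfl, ?_⟩
      have h1 : ((closeMajor (insert q c.active) α).active.card : ℝ) ≤ c.active.card + 1 := by
        exact_mod_cast Config.card_closeMajor.trans hcard
      have h2 := valuePotential_add_one_le hw hB hA hδ hc hm hq hqδ
        (Config.argmin_insert_le hw hc.feasible hα)
      rw [Config.value_closeMajor h0]
      push_cast
      linarith
    · have h1 := Config.card_closeMinor hc.feasible hθ
      refine Or.inr ⟨rfl, k, 1, c.active.card, _, le_rfl, rfl, by omega, hk, hle, Or.inr ?_⟩
      rcases hc.major hm with ⟨hp, hs⟩ | hd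
      · exact Or.inl fun β hβ => valuePotential_add_one_le hw hB hA hδ hc hm hq hqδ
          (Config.argmin_closeMinor_le hw hc.feasible (by linarith) hα hp hs hθ hβ)
      · exact Or.inr ⟨by rw [hd.closeMinor_active_eq_empty hθ, Finset.card_empty], hd.1⟩
  · obtain ⟨-, s, n, m, e, hn, rfl, hcard, hb, he, hcase⟩ := hk.resolve_left (by simp [hm])
    rcases hstep with ⟨h0, rfl⟩ | ⟨-, θ, hθ, rfl⟩
    · refine Or.inl ⟨rfl, ?_⟩
      have h1 : (closeMajor c.active α).active.card ≤ c.active.card := Config.card_closeMajor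
      push_cast
      rcases hcase with h2 | h2 | ⟨h2, rfl⟩
      · have h3 : (((closeMajor c.active α).active.card : ℝ)) + n ≤ m + 1 := by
          exact_mod_cast (by omega : (closeMajor c.active α).active.card + n ≤ m + 1)
        have h4 : (2 : ℝ) ≤ n := by exact_mod_cast h2
        linarith
      · have h3 : (((closeMajor c.active α).active.card : ℝ)) + n ≤ m + 1 := by
          exact_mod_cast (by omega : (closeMajor c.active α).active.card + n ≤ m + 1)
        have h4 : (1 : ℝ) ≤ n := by exact_mod_cast hn
        have h5 := h2 α hα
        rw [Config.value_closeMajor h0]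
        linarith
      · have h3 : (closeMajor c.active α).active.card = 0 := by omega
        have h4 : (n : ℝ) ≤ 2 := by exact_mod_cast (by omega : n ≤ 2)
        rw [h3, Nat.cast_zero]
        rw [Nat.cast_one] at hb
        linarith
    · have h1 := Config.card_closeMinor hc.feasible hθ
      exact Or.inr ⟨rfl, s, n + 1, m, e, by omega, by omega, by omega, hb, hle.trans he,
        Or.inl (by omega)⟩

theorem WithinBudget.le (hA : 0 < wNorm w a) (hδ : 0 < δ) (hB : Convex ℝ B) (hne : B.Nonempty)
    (hc : c.Feasible B) {b : ℝ} {k : ℕ} (hk : WithinBudget w a B δ b k c) : (k : ℝ) ≤ b + 1 := by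
  have hopt : optVal w a B ≤ c.value w a := optVal_le w a (hc.mem_inducedCone hB hne)
  have h0 : 0 ≤ valuePotential w a B δ (c.value w a) :=
    potential_nonneg hA one_add_maxNorm_sq_pos hδ (sub_nonneg.2 hopt)
  rcases hk with ⟨-, hk⟩ | ⟨-, s, n, m, e, -, rfl, hcard, hb, he, -⟩
  · have : (0 : ℝ) ≤ c.active.card := Nat.cast_nonneg _
    linarith
  · have h1 : (n : ℝ) ≤ m + 1 := by exact_mod_cast (by omega : n ≤ m + 1)
    have h2 : (0 : ℝ) ≤ m := Nat.cast_nonneg _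
    push_cast
    linarith

/-- If the test fails at the start of a major loop, then `δ` is small. -/
theorem lt_of_test_fails (hw : ∀ i, 0 < w i) (hB : IsCompact B)
    (hc : c.Invariant w a B) (hm : c.inMinor = false) {q : Fin N → ℝ} (hq : q ∈ B)
    (hqδ : wInner w (c.point - a) q + c.phi < -δ) : δ < wNorm w a * maxNorm w B := by
  have h1 := hc.value_le hw hm
  rw [Config.value, obj] at h1
  have h2 : wNorm w (c.point - a) ≤ wNorm w a := by
    refine le_of_sq_le_sq ?_ (Real.sqrt_nonneg _)
    nlinarith [sq_nonneg c.phi]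
  have h3 := (neg_le_abs _).trans (wInner_le hw (c.point - a) q)
  have h4 : wNorm w (c.point - a) * wNorm w q ≤ wNorm w a * maxNorm w B :=
    mul_le_mul h2 (wNorm_le_maxNorm w hB hq) (Real.sqrt_nonneg _) (Real.sqrt_nonneg _)
  linarith [hc.feasible.phi_nonneg]

theorem IsRun.length_le (hw : ∀ i, 0 < w i) (hB : IsCompact B) (hconv : Convex ℝ B) (hδ : 0 < δ)
    {q₁ : Fin N → ℝ} (hq₁ : q₁ ∈ B) {K : ℕ} {c : ℕ → Config N} (h : IsRun w a B δ q₁ K c) :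
    (K : ℝ) ≤ 20 * (N * wNorm w a * max (maxNorm w B ^ 2) 1 / δ) := by
  have hA0 : 0 ≤ wNorm w a := Real.sqrt_nonneg _
  have hmax : 1 ≤ max (maxNorm w B ^ 2) 1 := le_max_right _ _
  rcases Nat.eq_zero_or_pos K with rfl | hK
  · rw [Nat.cast_zero]; positivity
  have hI := h.invariant hw hq₁
  have hm0 : (c 0).inMinor = false := by rw [h.1]; rfl
  -- A first step means that the test failed at k = 0. This yields ‖a‖ > 0, N ≥ 1 and X ≥ 1 below.
  have hlt : δ < wNorm w a * maxNorm w B := by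
    obtain ⟨S, α, ⟨hm, q, hq, hqδ, -⟩ | ⟨hm, -⟩, -⟩ := h.2 0 hK
    · exact lt_of_test_fails hw hB (hI 0 (Nat.zero_le _)) hm hq.1 hqδ
    · simp [hm0] at hm
  have hA : 0 < wNorm w a := by
    rcases hA0.eq_or_lt with h0 | h0
    · rw [← h0, zero_mul] at hlt; linarith
    · exact h0
  have hN : (1 : ℝ) ≤ N := by
    rcases Nat.eq_zero_or_pos N with rfl | hN
    · simp [wNorm] at hA
    · exact_mod_cast hN
  have hQ : maxNorm w B ≤ max (maxNorm w B ^ 2) 1 := by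
    rcases le_or_gt (maxNorm w B) 1 with h1 | h1
    · exact h1.trans hmax
    · exact (by nlinarith : maxNorm w B ≤ maxNorm w B ^ 2).trans (le_max_left _ _)
  set X := wNorm w a * max (maxNorm w B ^ 2) 1 / δ with hX
  have hX1 : 1 ≤ X := by
    rw [hX, one_le_div hδ]
    exact hlt.le.trans (by gcongr)
  -- The 3 pays for the single initial point; 16 = 4 · 2 · 2 comes from the weight of the potential,
  -- the bound 2 on `saturate`, and 1 + Q² ≤ 2 max(Q², 1).
  have hbud : ∀ k ≤ K, WithinBudget w a B δ (3 + 16 * X) k (c k) := by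
    intro k
    induction k with
    | zero =>
      refine fun _ => Or.inl ⟨hm0, ?_⟩
      have h1 : (c 0).active.card = 1 := by rw [h.1]; rfl
      have h2 : valuePotential w a B δ ((c 0).value w a) ≤ 2 * (2 * X) := by
        refine (potential_le hA one_add_maxNorm_sq_pos hδ _).trans ?_
        have h3 : wNorm w a * (1 + maxNorm w B ^ 2) / δ ≤
            wNorm w a * (2 * max (maxNorm w B ^ 2) 1) / δ := by
          gcongr
          linarith [le_max_left (maxNorm w B ^ 2) 1]
        have h4 : wNorm w a * (2 * max (maxNorm w B ^ 2) 1) / δ = 2 * X := by rw [hX]; ring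
        linarith
      rw [h1]
      push_cast
      linarith
    | succ k ih =>
      exact fun hk => (ih (by omega)).step hw hB hA hδ (hI k (by omega)) (h.2 k hk)
  have h1 := (hbud K le_rfl).le hA hδ hconv ⟨q₁, hq₁⟩ (hI K le_rfl).feasible
  have h2 : N * wNorm w a * max (maxNorm w B ^ 2) 1 / δ = N * X := by rw [hX]; ring
  -- K ≤ 4 + 16 X ≤ 20 X, a bound without the dimension; N enters only through N ≥ 1.
  rw [h2]
  nlinarith

end Runs

end ConicMNP

/-- Guarantees of the conic min-norm-point method, with one absolute constant `M`. Every run, from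
every starting point and for every choice of the minimizers that it computes, stays in the cone and
decreases `h`; its counter never exceeds the bound; and it either has stopped, with a value that is
optimal up to `δ ‖a‖_W`, or goes on. -/
theorem theorem5p1 :
    ∃ M : ℝ, 0 < M ∧
      ∀ (N : ℕ) (w a : Fin N → ℝ) (B : Set (Fin N → ℝ)) (δ : ℝ) (q₁ : Fin N → ℝ),
        (∀ i, 0 < w i) → ConicMNP.IsPolytope B → 0 < δ → q₁ ∈ B →
        ∀ (K : ℕ) (c : ℕ → ConicMNP.Config N), ConicMNP.IsRun w a B δ q₁ K c →
          (∀ k ≤ K, ((c k).point, (c k).phi) ∈ ConicMNP.inducedCone B) ∧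
          (∀ k < K, (c (k + 1)).value w a ≤ (c k).value w a) ∧
          (∀ k < K, (c k).inMinor = false → (0 < k ∨ 0 < ConicMNP.wInner w a q₁) →
            (c (k + 1)).value w a < (c k).value w a) ∧
          (K : ℝ) ≤ M * (N * ConicMNP.wNorm w a * max (ConicMNP.maxNorm w B ^ 2) 1 / δ) ∧
          ((ConicMNP.Stops w a B δ (c K) ∧
              (c K).value w a ≤ ConicMNP.optVal w a B + δ * ConicMNP.wNorm w a) ∨
            (¬ ConicMNP.Stops w a B δ (c K) ∧ ∃ c', ConicMNP.Step w a B δ (c K) c')) := by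
  refine ⟨20, by norm_num, fun N w a B δ q₁ hw hB hδ hq₁ K c h => ?_⟩
  have hne : B.Nonempty := ⟨q₁, hq₁⟩
  have hI := h.invariant hw hq₁
  refine ⟨fun k hk => (hI k hk).feasible.mem_inducedCone hB.convex hne,
    fun k hk => (h.2 k hk).value_le hw (hI k hk.le).feasible, fun k hk hm hpos => ?_,
    h.length_le hw hB.isCompact hB.convex hδ hq₁, ?_⟩
  · have hps : (c k).Positive ∧ (c k).Stationary w a := by
      cases k with
      | zero =>
        rw [h.1]
        exact ConicMNP.Config.positive_stationary_initConfig hw hq₁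
          (hpos.resolve_left (lt_irrefl 0))
      | succ k =>
        exact (h.2 k (by omega)).positive_stationary hw (hI k (by omega)).feasible hm
    exact (h.2 k hk).value_lt hw hδ (hI k hk.le).feasible hm hps.1 hps.2
  · by_cases hs : ConicMNP.Stops w a B δ (c K)
    · exact Or.inl ⟨hs, by
        linarith [ConicMNP.sub_optVal_le_of_stops hw hne hδ (hI K le_rfl) hs]⟩
    · exact Or.inr ⟨hs, ConicMNP.exists_step hw hB.isCompact hne hs⟩
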